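/- Let $J\ge 1$ and $d\ge 0$ be integers, let $\lambda_0,\dots,\lambda_{J-1}\ge 0$ with $\sum_j\lambda_j=1$, and for $x=(x_0,\dots,x_{J-1})\in(\mathbb R^d)^J$ put $$c(x)=\frac12\sum_{i,j=0}^{J-1}\lambda_i\lambda_j\|x_i-x_j\|^2=\sum_{i=0}^{J-1}\lambda_i\Big\|x_i-\sum_{j}\lambda_jx_j\Big\|^2 .$$ For probability measures $\nu_0,\dots,\nu_{J-1}$ on $\mathbb R^d$ let $\Pi(\nu_0,\dots,\nu_{J-1})$ be the set of probability measures on $(\mathbb R^d)^J$ with marginals $\nu_0,\dots,\nu_{J-1}$, and let $mmW_2^2(\nu_0,\dots,\nu_{J-1})=\inf_{\gamma\in\Pi(\nu_0,\dots,\nu_{J-1})}\int c\,d\gamma$; a $\gamma$ attaining this infimum is called an optimal multi-marginal plan. A finite Gaussian mixture is a convex combination of finitely many (possibly degenerate) Gaussian probability measures. Let $MMW_2^2(\nu_0,\dots,\nu_{J-1})$ be the infimum of $\int c\,d\gamma$ over those $\gamma\in\Pi(\nu_0,\dots,\nu_{J-1})$ that are finite Gaussian mixtures on $(\mathbb R^d)^J$.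 For each $j$ let $\mu_j=\sum_{k=1}^{K_j}\pi_j^k\mu_j^k$, where the $\mu_j^k$ are (possibly degenerate) Gaussian measures on $\mathbb R^d$, $\pi_j^k\ge 0$ and $\sum_k\pi_j^k=1$. Let $\Pi(\pi_0,\dots,\pi_{J-1})$ be the set of nonnegative tensors $w=(w_{k_0\dots k_{J-1}})_{1\le k_j\le K_j}$ such that $\sum_{k_0,\dots,k_{J-1}:\,k_j=k}w_{k_0\dots k_{J-1}}=\pi_j^k$ for all $j$ and $k$. Then: 1. $MMW_2^2(\mu_0,\dots,\mu_{J-1})$ is finite and $$MMW_2^2(\mu_0,\dots,\mu_{J-1})=\min_{w\in\Pi(\pi_0,\dots,\pi_{J-1})}\ \sum_{k_0,\dots,k_{J-1}}w_{k_0\dots k_{J-1}}\,mmW_2^2(\mu_0^{k_0},\dots,\mu_{J-1}^{k_{J-1}}),$$ the minimum on the right being attained. 2. For all $k_0,\dots,k_{J-1}$ there is an optimal multi-marginal plan between $\mu_0^{k_0},\dots,\mu_{J-1}^{k_{J-1}}$ that is Gaussian. If $w^*$ is any minimizer of the discrete problem and $\gamma^*_{k_0\dots k_{J-1}}$ are any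 such Gaussian optimal plans, then $$\gamma^*=\sum_{k_0,\dots,k_{J-1}}w^*_{k_0\dots k_{J-1}}\gamma^*_{k_0\dots k_{J-1}}$$ is a finite Gaussian mixture in $\Pi(\mu_0,\dots,\mu_{J-1})$ that attains the infimum defining $MMW_2^2(\mu_0,\dots,\mu_{J-1})$. 3. Conversely, every $\gamma^*$ attaining the infimum defining $MMW_2^2(\mu_0,\dots,\mu_{J-1})$ can be written in this form, where $w^*$ is a minimizer of the discrete problem and each $\gamma^*_{k_0\dots k_{J-1}}$ is an optimal multi-marginal plan between $\mu_0^{k_0},\dots,\mu_{J-1}^{k_{J-1}}$ that is a finite Gaussian mixture. -/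

import Mathlib

open MeasureTheory ProbabilityTheory
open scoped NNReal ENNReal

noncomputable section

namespace GMMOT

/-- `ℝ^d` with its Euclidean norm. -/
abbrev Rd (d : ℕ) : Type := EuclideanSpace ℝ (Fin d)

/-- The finite mixture `∑ₖ πₖ μₖ` of a family of measures. -/
def mixture {ι E : Type*} [Fintype ι] [MeasurableSpace E] (p : ι → ℝ≥0) (μ : ι → Measure E) :
    Measure E :=
  ∑ k, p k • μ k

/-- `μ` is a finite Gaussian mixture: `μ = ∑ₖ πₖ μₖ` with `π` in the simplex and every `μₖ` a
(possibly degenerate) Gaussian probability measure. -/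
def IsGMM {E : Type*} [TopologicalSpace E] [AddCommMonoid E] [Module ℝ E] [MeasurableSpace E]
    (μ : Measure E) : Prop :=
  ∃ (K : ℕ) (p : Fin K → ℝ≥0) (ν : Fin K → Measure E),
    ∑ k, p k = 1 ∧ (∀ k, IsGaussian (ν k)) ∧ μ = mixture p ν

/-- `Π(μ₀, …, μ_{J-1})`: probability measures on `(ℝ^d)^J` with marginals `μ₀, …, μ_{J-1}`. -/
def couplings {J d : ℕ} (μ : Fin J → Measure (Rd d)) : Set (Measure (Fin J → Rd d)) :=
  {γ | IsProbabilityMeasure γ ∧ ∀ j, γ.map (fun x => x j) = μ j}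

/-- The weighted barycenter `B(x) = ∑ᵢ λᵢ xᵢ`. -/
def bary {J d : ℕ} (lam : Fin J → ℝ) (x : Fin J → Rd d) : Rd d := ∑ i, lam i • x i

/-- The cost `c(x) = ½ ∑ᵢⱼ λᵢ λⱼ ‖xᵢ - xⱼ‖²`. -/
def cost {J d : ℕ} (lam : Fin J → ℝ) (x : Fin J → Rd d) : ℝ :=
  (1 / 2) * ∑ i, ∑ j, lam i * lam j * ‖x i - x j‖ ^ 2

/-- For weights summing to one, the cost is also `∑ᵢ λᵢ ‖xᵢ - B(x)‖²`. -/
theorem cost_eq_sum_bary {J d : ℕ} (lam : Fin J → ℝ) (hsum : ∑ j, lam j = 1)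
    (x : Fin J → Rd d) : cost lam x = ∑ i, lam i * ‖x i - bary lam x‖ ^ 2 := by
  have hB : ∀ y : Rd d, inner ℝ y (bary lam x) = ∑ j, lam j * inner ℝ y (x j) := by
    intro y
    simp [bary, inner_sum, inner_smul_right]
  have hBB : inner ℝ (bary lam x) (bary lam x) = ∑ i, lam i * inner ℝ (x i) (bary lam x) := by
    rw [hB]
    exact Finset.sum_congr rfl fun i _ => by rw [real_inner_comm]
  have h1 : ∀ i, lam i * ‖x i - bary lam x‖ ^ 2 = lam i * ‖x i‖ ^ 2
      - 2 * (lam i * inner ℝ (x i) (bary lam x)) + lam i * ‖bary lam x‖ ^ 2 := by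
    intro i
    rw [norm_sub_sq_real]
    ring
  have h2 : ∀ i, ∑ j, lam i * lam j * ‖x i - x j‖ ^ 2 = lam i * ‖x i‖ ^ 2
      - 2 * (lam i * inner ℝ (x i) (bary lam x)) + lam i * ∑ j, lam j * ‖x j‖ ^ 2 := by
    intro i
    have : ∀ j, lam i * lam j * ‖x i - x j‖ ^ 2 = lam j * (lam i * ‖x i‖ ^ 2)
        - 2 * lam i * (lam j * inner ℝ (x i) (x j)) + lam i * (lam j * ‖x j‖ ^ 2) := by
      intro j
      rw [norm_sub_sq_real]
      ring
    simp only [this, Finset.sum_add_distrib, Finset.sum_sub_distrib, ← Finset.mul_sum,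
      ← Finset.sum_mul, hsum, hB]
    ring
  rw [cost]
  simp only [h1, h2, Finset.sum_add_distrib, Finset.sum_sub_distrib, ← Finset.mul_sum,
    ← Finset.sum_mul, hsum, ← hBB, real_inner_self_eq_norm_sq]
  ring

/-- The transport cost `∫ c dγ ∈ [0, ∞]` of a plan (the cost is nonnegative when `λ ≥ 0`). -/
def planCost {J d : ℕ} (lam : Fin J → ℝ) (γ : Measure (Fin J → Rd d)) : ℝ≥0∞ :=
  ∫⁻ x, ENNReal.ofReal (cost lam x) ∂γ

/-- `mmW₂²(μ₀, …, μ_{J-1})`: infimum of the transport cost over all couplings. -/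
def mmW2sq {J d : ℕ} (lam : Fin J → ℝ) (μ : Fin J → Measure (Rd d)) : ℝ≥0∞ :=
  ⨅ γ ∈ couplings μ, planCost lam γ

/-- `MMW₂²(μ₀, …, μ_{J-1})`: infimum of the transport cost over couplings that are finite
Gaussian mixtures on `(ℝ^d)^J`. -/
def MMW2sq {J d : ℕ} (lam : Fin J → ℝ) (μ : Fin J → Measure (Rd d)) : ℝ≥0∞ :=
  ⨅ γ ∈ couplings μ ∩ {γ | IsGMM γ}, planCost lam γ

/-- `γ` is an optimal plan for `mmW₂²(μ₀, …, μ_{J-1})`. -/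
def IsOptimalPlan {J d : ℕ} (lam : Fin J → ℝ) (μ : Fin J → Measure (Rd d))
    (γ : Measure (Fin J → Rd d)) : Prop :=
  γ ∈ couplings μ ∧ planCost lam γ = mmW2sq lam μ

/-- `γ` is a solution of the problem `MMW₂²(μ₀, …, μ_{J-1})`. -/
def IsOptimalGMMPlan {J d : ℕ} (lam : Fin J → ℝ) (μ : Fin J → Measure (Rd d))
    (γ : Measure (Fin J → Rd d)) : Prop :=
  γ ∈ couplings μ ∧ IsGMM γ ∧ planCost lam γ = MMW2sq lam μ

/-- `Π(π₀, …, π_{J-1})`: nonnegative tensors of size `K₀ × ⋯ × K_{J-1}` with discrete marginals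
`π₀, …, π_{J-1}`. -/
def tensorCouplings {J : ℕ} {K : Fin J → ℕ} (p : ∀ j, Fin (K j) → ℝ≥0) :
    Set ((∀ j, Fin (K j)) → ℝ≥0) :=
  {w | ∀ (j : Fin J) (k : Fin (K j)), ∑ κ with κ j = k, w κ = p j k}

/-- The objective `∑ w_{k₀…k_{J-1}} mmW₂²(μ₀^{k₀}, …, μ_{J-1}^{k_{J-1}})` of the discrete
multi-marginal linear program. -/
def discreteCost {J d : ℕ} {K : Fin J → ℕ} (lam : Fin J → ℝ)
    (comp : ∀ j, Fin (K j) → Measure (Rd d)) (w : (∀ j, Fin (K j)) → ℝ≥0) : ℝ≥0∞ :=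
  ∑ κ, (w κ : ℝ≥0∞) * mmW2sq lam (fun j => comp j (κ j))

/-- `w` is a solution of the discrete multi-marginal linear program. -/
def IsOptimalTensor {J d : ℕ} {K : Fin J → ℕ} (lam : Fin J → ℝ) (p : ∀ j, Fin (K j) → ℝ≥0)
    (comp : ∀ j, Fin (K j) → Measure (Rd d)) (w : (∀ j, Fin (K j)) → ℝ≥0) : Prop :=
  w ∈ tensorCouplings p ∧
    ∀ w' ∈ tensorCouplings p, discreteCost lam comp w ≤ discreteCost lam comp w'

end GMMOT

end

namespace GMMOT

/-! ### Gaussian measures and their coordinate moments -/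

/-! The proof rests on two facts. (1) Between Gaussian marginals the cost of a coupling depends only
on the coordinate means, which the marginals fix, and on the joint covariance matrix
(`planCost_eq_momentCost`). The admissible matrices, positive semidefinite with prescribed diagonal
blocks, form a compact set, and each is the covariance of a Gaussian coupling. Minimizing a
continuous function over them gives a Gaussian plan that is optimal among all couplings
(`exists_isGaussian_isOptimalPlan`). (2) Distinct Gaussians are linearly independent, so a finite
Gaussian mixture determines the total weight of each Gaussian in it
(`fiber_weight_eq_of_mixture_eq`). The marginals of the components of a mixture plan are therefore,
up to zero weights, components of the given mixtures. Splitting weights among repeated components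
writes the plan as a tensor-weighted mixture of plans between components (`exists_decomposition`).
Since the cost is linear in the plan, (2) bounds every mixture plan below by the discrete objective
at its tensor, and (1) shows that this bound is attained. The equality case of the termwise bound
gives the converse. -/

theorem covarianceBilin_eq_sum_cov {d : ℕ} (μ : Measure (Rd d)) [IsGaussian μ] (x y : Rd d) :
    covarianceBilin μ x y =
      ∑ a, ∑ b, x a * y b * cov[fun z : Rd d => z a, fun z => z b; μ] := by
  have h := covarianceBilin_apply_pi (μ := μ) (X := fun a (z : Rd d) => z a)
    (fun a => IsGaussian.memLp_dual μ (EuclideanSpace.proj a) 2 (by simp)) x y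
  rw [← h]
  have : (fun z : Rd d => WithLp.toLp 2 fun a => z a) = id := rfl
  rw [this, Measure.map_id]

theorem integral_apply {d : ℕ} (μ : Measure (Rd d)) [IsGaussian μ] (a : Fin d) :
    (∫ x, x ∂μ) a = ∫ x : Rd d, x a ∂μ :=
  (IsGaussian.integral_dual (EuclideanSpace.proj (𝕜 := ℝ) a : Rd d →L[ℝ] ℝ)).symm

/-- A Gaussian measure is determined by the means and covariances of the coordinates. -/
theorem gaussian_ext_of_coord {d : ℕ} {μ ν : Measure (Rd d)} [IsGaussian μ] [IsGaussian ν]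
    (hm : ∀ a, ∫ x : Rd d, x a ∂μ = ∫ x : Rd d, x a ∂ν)
    (hc : ∀ a b, cov[fun z : Rd d => z a, fun z => z b; μ] =
      cov[fun z : Rd d => z a, fun z => z b; ν]) : μ = ν := by
  refine IsGaussian.ext ?_ ?_
  · ext a
    simpa [integral_apply] using hm a
  · ext x y
    simp only [covarianceBilin_eq_sum_cov, hc]

/-! ### Couplings of Gaussian measures -/

section Coupling

variable {J d : ℕ} {μ : Fin J → Measure (Rd d)} {γ : Measure (Fin J → Rd d)}

theorem continuous_coord (j : Fin J) (a : Fin d) :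
    Continuous fun x : Fin J → Rd d => x j a :=
  (EuclideanSpace.proj (𝕜 := ℝ) a : Rd d →L[ℝ] ℝ).continuous.comp (continuous_apply j)

theorem aemeasurable_eval (j : Fin J) (γ : Measure (Fin J → Rd d)) :
    AEMeasurable (fun x : Fin J → Rd d => x j) γ :=
  (measurable_pi_apply j).aemeasurable

theorem memLp_coord_of_mem_couplings (hμ : ∀ j, IsGaussian (μ j)) (hγ : γ ∈ couplings μ)
    (j : Fin J) (a : Fin d) : MemLp (fun x : Fin J → Rd d => x j a) 2 γ := by
  have := hμ j
  have h : MemLp (fun y : Rd d => y a) 2 (μ j) :=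
    IsGaussian.memLp_dual (μ j) (EuclideanSpace.proj a) 2 (by simp)
  rw [← hγ.2 j, memLp_map_measure_iff (by fun_prop) (aemeasurable_eval j _)] at h
  exact h

theorem integral_coord_of_mem_couplings (hγ : γ ∈ couplings μ) (j : Fin J) (a : Fin d) :
    ∫ x, x j a ∂γ = ∫ y : Rd d, y a ∂(μ j) := by
  rw [← hγ.2 j, integral_map (aemeasurable_eval j _) (by fun_prop)]

theorem cov_coord_of_mem_couplings (hγ : γ ∈ couplings μ) (j : Fin J) (a b : Fin d) :
    cov[fun x : Fin J → Rd d => x j a, fun x => x j b; γ] =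
      cov[fun y : Rd d => y a, fun y => y b; μ j] := by
  rw [← hγ.2 j, covariance_map_fun (by fun_prop) (by fun_prop)
    (aemeasurable_eval j _)]

/-- The expected cost of a plan, as a function of the mean `m` and the covariance matrix `S` of the
coordinates. -/
noncomputable def momentCost (lam : Fin J → ℝ) (m : Fin J × Fin d → ℝ)
    (S : Matrix (Fin J × Fin d) (Fin J × Fin d) ℝ) : ℝ :=
  (1 / 2) * ∑ i, ∑ j, lam i * lam j * ∑ a, ((m (i, a) - m (j, a)) ^ 2 +
    (S (i, a) (i, a) - 2 * S (i, a) (j, a) + S (j, a) (j, a)))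

/-- The means of the coordinates of a coupling of `μ`. -/
noncomputable def coordMean (μ : Fin J → Measure (Rd d)) (u : Fin J × Fin d) : ℝ :=
  ∫ y : Rd d, y u.2 ∂(μ u.1)

/-- The covariance matrix of the coordinates. -/
noncomputable def coordCov (γ : Measure (Fin J → Rd d)) :
    Matrix (Fin J × Fin d) (Fin J × Fin d) ℝ :=
  Matrix.of fun u v => cov[fun x : Fin J → Rd d => x u.1 u.2, fun x => x v.1 v.2; γ]

theorem cost_nonneg {lam : Fin J → ℝ} (hlam : ∀ j, 0 ≤ lam j) (x : Fin J → Rd d) :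
    0 ≤ cost lam x := by
  unfold cost
  have := fun i j => mul_nonneg (hlam i) (hlam j)
  exact mul_nonneg (by norm_num) (Finset.sum_nonneg fun i _ => Finset.sum_nonneg fun j _ =>
    mul_nonneg (this i j) (sq_nonneg _))

/-- The second moment of each difference of coordinates is its squared mean plus its variance, and
the variance expands into covariances. The off-diagonal blocks of the covariance are thus the only
quantities the coupling can still vary. -/
theorem planCost_eq_momentCost {lam : Fin J → ℝ} (hlam : ∀ j, 0 ≤ lam j)
    (hμ : ∀ j, IsGaussian (μ j)) (hγ : γ ∈ couplings μ) :
    planCost lam γ = ENNReal.ofReal (momentCost lam (coordMean μ) (coordCov γ)) := by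
  have := hγ.1
  have hL := memLp_coord_of_mem_couplings hμ hγ
  have hcost : ∀ x : Fin J → Rd d, cost lam x =
      (1 / 2) * ∑ i, ∑ j, lam i * lam j * ∑ a, (x i a - x j a) ^ 2 := by
    intro x
    simp [cost, EuclideanSpace.norm_sq_eq]
  have hsq : ∀ i j a, Integrable (fun x : Fin J → Rd d => (x i a - x j a) ^ 2) γ :=
    fun i j a => ((hL i a).sub (hL j a)).integrable_sq
  have hint : ∀ i j, Integrable
      (fun x : Fin J → Rd d => lam i * lam j * ∑ a, (x i a - x j a) ^ 2) γ :=
    fun i j => (integrable_finsetSum _ fun a _ => hsq i j a).const_mul _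
  have hI : Integrable (fun x => cost lam x) γ := by
    simp only [hcost]
    exact (integrable_finsetSum _ fun i _ => integrable_finsetSum _ fun j _ =>
      hint i j).const_mul _
  have hval : ∀ i j a, ∫ x : Fin J → Rd d, (x i a - x j a) ^ 2 ∂γ =
      (coordMean μ (i, a) - coordMean μ (j, a)) ^ 2 + (coordCov γ (i, a) (i, a)
        - 2 * coordCov γ (i, a) (j, a) + coordCov γ (j, a) (j, a)) := by
    intro i j a
    have h1 := variance_sub (hL i a) (hL j a)
    have h2 := variance_eq_sub ((hL i a).sub (hL j a))
    have h3 : ∫ x : Fin J → Rd d, (x i a - x j a) ∂γ = coordMean μ (i, a) - coordMean μ (j, a) := by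
      rw [integral_sub ((hL i a).integrable (by norm_num)) ((hL j a).integrable (by norm_num)),
        integral_coord_of_mem_couplings hγ, integral_coord_of_mem_couplings hγ]
      rfl
    simp only [Pi.pow_apply, Pi.sub_apply] at h2
    rw [h3] at h2
    simp only [coordCov, Matrix.of_apply]
    rw [covariance_self (hL i a).aestronglyMeasurable.aemeasurable,
      covariance_self (hL j a).aestronglyMeasurable.aemeasurable, ← h1, h2]
    ring
  rw [planCost, ← ofReal_integral_eq_lintegral_ofReal hI
    (Filter.Eventually.of_forall fun x => cost_nonneg hlam x)]
  congr 1
  simp only [hcost]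
  rw [integral_const_mul, integral_finsetSum _ fun i _ => integrable_finsetSum _ fun j _ => hint i j]
  unfold momentCost
  congr 1
  refine Finset.sum_congr rfl fun i _ => ?_
  rw [integral_finsetSum _ fun j _ => hint i j]
  refine Finset.sum_congr rfl fun j _ => ?_
  rw [integral_const_mul, integral_finsetSum _ fun a _ => hsq i j a]
  simp only [hval]

theorem posSemidef_coordCov (hμ : ∀ j, IsGaussian (μ j)) (hγ : γ ∈ couplings μ) :
    (coordCov γ).PosSemidef := by
  have := hγ.1
  have hL := memLp_coord_of_mem_couplings hμ hγ
  refine Matrix.PosSemidef.of_dotProduct_mulVec_nonneg ?_ fun x => ?_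
  · ext u v
    simp [coordCov, covariance_comm]
  · have h := covarianceBilin_apply_pi (μ := γ)
      (X := fun (u : Fin J × Fin d) (x : Fin J → Rd d) => x u.1 u.2)
      (fun u => hL u.1 u.2) (WithLp.toLp 2 x) (WithLp.toLp 2 x)
    have h0 := covarianceBilin_self_nonneg (μ := γ.map fun x => WithLp.toLp 2
      fun u : Fin J × Fin d => x u.1 u.2) (WithLp.toLp 2 x)
    rw [h] at h0
    refine h0.trans_eq ?_
    simp only [dotProduct, Matrix.mulVec, Finset.mul_sum, coordCov, Matrix.of_apply, star_trivial]
    exact Finset.sum_congr rfl fun u _ => Finset.sum_congr rfl fun v _ => by ring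

/-- The candidate covariance matrices of couplings of `μ`: positive semidefinite matrices with
prescribed diagonal blocks. -/
def covSet (μ : Fin J → Measure (Rd d)) : Set (Matrix (Fin J × Fin d) (Fin J × Fin d) ℝ) :=
  {S | S.PosSemidef ∧ ∀ j a b, S (j, a) (j, b) = cov[fun y : Rd d => y a, fun y => y b; μ j]}

theorem coordCov_mem_covSet (hμ : ∀ j, IsGaussian (μ j)) (hγ : γ ∈ couplings μ) :
    coordCov γ ∈ covSet μ :=
  ⟨posSemidef_coordCov hμ hγ, fun j a b => cov_coord_of_mem_couplings hγ j a b⟩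

/-- Test the quadratic form on `e_u + e_v` and `e_u - e_v`. Prescribed diagonal entries thereby
bound all the others, which makes `covSet` bounded. -/
theorem abs_apply_le_of_posSemidef {n : Type*} [Fintype n] [DecidableEq n] {S : Matrix n n ℝ}
    (hS : S.PosSemidef) (u v : n) : |S u v| ≤ (S u u + S v v) / 2 := by
  have hsymm : S v u = S u v := by
    simpa using congrFun (congrFun hS.isHermitian u) v
  have h1 := hS.dotProduct_mulVec_nonneg (Pi.single u 1 + Pi.single v 1)
  have h2 := hS.dotProduct_mulVec_nonneg (Pi.single u 1 - Pi.single v 1)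
  simp [Matrix.mulVec_add, Matrix.mulVec_sub, add_dotProduct, sub_dotProduct, hsymm] at h1 h2
  rw [abs_le]
  constructor <;> linarith

theorem isClosed_posSemidef {n : Type*} [Fintype n] :
    IsClosed {S : Matrix n n ℝ | S.PosSemidef} := by
  have : {S : Matrix n n ℝ | S.PosSemidef} = {S | S.conjTranspose = S} ∩
      ⋂ x : n → ℝ, {S | 0 ≤ star x ⬝ᵥ S.mulVec x} := by
    ext S
    simp only [Set.mem_ofPred_eq, Set.mem_inter_iff, Set.mem_iInter]
    exact ⟨fun h => ⟨h.isHermitian, h.dotProduct_mulVec_nonneg⟩,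
      fun h => .of_dotProduct_mulVec_nonneg h.1 h.2⟩
  rw [this]
  refine (isClosed_eq (by fun_prop) continuous_id).inter (isClosed_iInter fun x => ?_)
  exact isClosed_le continuous_const
    (continuous_const.dotProduct (continuous_id.matrix_mulVec continuous_const))

theorem isCompact_covSet (μ : Fin J → Measure (Rd d)) : IsCompact (covSet μ) := by
  have hcl : IsClosed (covSet μ) := by
    have : covSet μ = {S | S.PosSemidef} ∩ ⋂ j, ⋂ a, ⋂ b, {S | S (j, a) (j, b) =
        cov[fun y : Rd d => y a, fun y => y b; μ j]} := by
      ext S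
      simp [covSet]
    rw [this]
    exact isClosed_posSemidef.inter <| isClosed_iInter fun j => isClosed_iInter fun a =>
      isClosed_iInter fun b => isClosed_eq (continuous_id.matrix_elem _ _) continuous_const
  let D : Fin J × Fin d → ℝ := fun u => cov[fun y : Rd d => y u.2, fun y => y u.2; μ u.1]
  have hK : IsCompact (Set.univ.pi fun u : Fin J × Fin d => Set.univ.pi fun v : Fin J × Fin d =>
      Set.Icc (-((D u + D v) / 2)) ((D u + D v) / 2)) :=
    isCompact_univ_pi fun u => isCompact_univ_pi fun v => isCompact_Icc
  refine hK.of_isClosed_subset hcl fun S hS => ?_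
  intro u _ v _
  have := abs_apply_le_of_posSemidef hS.1 u v
  rw [hS.2 u.1 u.2 u.2, hS.2 v.1 v.2 v.2] at this
  exact abs_le.mp this

theorem pi_mem_couplings (hμ : ∀ j, IsGaussian (μ j)) : Measure.pi μ ∈ couplings μ := by
  refine ⟨inferInstance, fun j => ?_⟩
  have := Measure.pi_map_eval μ j
  simpa using this

theorem nonempty_covSet (hμ : ∀ j, IsGaussian (μ j)) : (covSet μ).Nonempty :=
  ⟨_, coordCov_mem_covSet hμ (pi_mem_couplings hμ)⟩

/-- The linear map grouping the coordinates of `ℝ^(J × d)` into `J` vectors of `ℝ^d`. -/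
noncomputable def blockMap (J d : ℕ) : EuclideanSpace ℝ (Fin J × Fin d) →L[ℝ] (Fin J → Rd d) :=
  LinearMap.toContinuousLinearMap
    { toFun := fun x j => WithLp.toLp 2 fun a => x (j, a)
      map_add' := fun _ _ => rfl
      map_smul' := fun _ _ => rfl }

theorem blockMap_apply (x : EuclideanSpace ℝ (Fin J × Fin d)) (j : Fin J) (a : Fin d) :
    blockMap J d x j a = x (j, a) := rfl

/-- The Gaussian plan with the coordinate means of `μ` and covariance matrix `S`. -/
noncomputable def gaussianPlan (μ : Fin J → Measure (Rd d))
    (S : Matrix (Fin J × Fin d) (Fin J × Fin d) ℝ) : Measure (Fin J → Rd d) :=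
  (multivariateGaussian (WithLp.toLp 2 (coordMean μ)) S).map (blockMap J d)

instance isGaussian_gaussianPlan (S : Matrix (Fin J × Fin d) (Fin J × Fin d) ℝ) :
    IsGaussian (gaussianPlan μ S) := by
  unfold gaussianPlan
  infer_instance

theorem coordCov_gaussianPlan {S : Matrix (Fin J × Fin d) (Fin J × Fin d) ℝ}
    (hS : S.PosSemidef) : coordCov (gaussianPlan μ S) = S := by
  ext u v
  simp only [coordCov, Matrix.of_apply, gaussianPlan]
  rw [covariance_map_fun (continuous_coord _ _).aestronglyMeasurable
    (continuous_coord _ _).aestronglyMeasurable (by fun_prop)]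
  exact covariance_eval_multivariateGaussian hS u v

/-- Each marginal is a linear image of a Gaussian, hence Gaussian, so matching means and diagonal
covariance blocks is enough. -/
theorem gaussianPlan_mem_couplings (hμ : ∀ j, IsGaussian (μ j))
    {S : Matrix (Fin J × Fin d) (Fin J × Fin d) ℝ} (hS : S ∈ covSet μ) :
    gaussianPlan μ S ∈ couplings μ := by
  refine ⟨inferInstance, fun j => ?_⟩
  have := hμ j
  have hG : IsGaussian ((gaussianPlan μ S).map (fun x => x j)) :=
    isGaussian_map (ContinuousLinearMap.proj (R := ℝ) (φ := fun _ : Fin J => Rd d) j)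
  refine gaussian_ext_of_coord (fun a => ?_) fun a b => ?_
  · rw [integral_map (aemeasurable_eval j _) (by fun_prop), gaussianPlan,
      integral_map (by fun_prop) (continuous_coord _ _).aestronglyMeasurable]
    simp only [blockMap_apply]
    have h := IsGaussian.integral_dual
      (μ := multivariateGaussian (WithLp.toLp 2 (coordMean μ)) S)
      (EuclideanSpace.proj (𝕜 := ℝ) (j, a) : EuclideanSpace ℝ (Fin J × Fin d) →L[ℝ] ℝ)
    rw [integral_id_multivariateGaussian] at h
    exact h
  · rw [covariance_map_fun (by fun_prop) (by fun_prop) (aemeasurable_eval j _),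
      ← hS.2 j a b]
    exact congrFun (congrFun (coordCov_gaussianPlan (μ := μ) hS.1) (j, a)) (j, b)

/-- Gaussian measures have a Gaussian optimal multi-marginal plan. -/
theorem exists_isGaussian_isOptimalPlan {lam : Fin J → ℝ} (hlam : ∀ j, 0 ≤ lam j)
    (hμ : ∀ j, IsGaussian (μ j)) :
    ∃ γ : Measure (Fin J → Rd d), IsGaussian γ ∧ IsOptimalPlan lam μ γ := by
  have hcont : Continuous fun S => momentCost lam (coordMean μ) S := by
    unfold momentCost
    fun_prop
  obtain ⟨S, hS, hmin⟩ := (isCompact_covSet μ).exists_isMinOn (nonempty_covSet hμ)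
    hcont.continuousOn
  refine ⟨gaussianPlan μ S, inferInstance, gaussianPlan_mem_couplings hμ hS,
    le_antisymm (le_iInf₂ fun γ hγ => ?_) (iInf₂_le _ (gaussianPlan_mem_couplings hμ hS))⟩
  rw [planCost_eq_momentCost hlam hμ hγ,
    planCost_eq_momentCost hlam hμ (gaussianPlan_mem_couplings hμ hS), coordCov_gaussianPlan hS.1]
  exact ENNReal.ofReal_le_ofReal (hmin (coordCov_mem_covSet hμ hγ))

theorem mmW2sq_lt_top {lam : Fin J → ℝ} (hlam : ∀ j, 0 ≤ lam j)
    (hμ : ∀ j, IsGaussian (μ j)) : mmW2sq lam μ < ⊤ := by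
  refine (iInf₂_le _ (pi_mem_couplings hμ)).trans_lt ?_
  rw [planCost_eq_momentCost hlam hμ (pi_mem_couplings hμ)]
  exact ENNReal.ofReal_lt_top

end Coupling

end GMMOT

namespace GMMOT

/-! ### Identifiability of finite Gaussian mixtures -/

open Filter Topology in
theorem tendsto_exp_linear_add_sq {a v : ℝ} (h : v < 0 ∨ v = 0 ∧ a < 0) :
    Tendsto (fun t : ℝ => Real.exp (a * t + v * t ^ 2)) atTop (𝓝 0) := by
  refine Real.tendsto_exp_atBot.comp ?_
  rcases h with h | ⟨rfl, h⟩
  · have h1 : Tendsto (fun t : ℝ => a + v * t) atTop atBot :=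
      tendsto_atBot_add_const_left _ _ (tendsto_id.const_mul_atTop_of_neg h)
    refine (tendsto_id.atTop_mul_atBot₀ h1).congr fun t => ?_
    simp only [id]
    ring
  · simpa using tendsto_id.const_mul_atTop_of_neg h

open Filter Topology in
/-- The functions `t ↦ exp (a t + v t²)` are linearly independent. -/
theorem coeff_eq_zero_of_sum_exp_eq_zero {ι : Type*} (s : Finset ι) (c a v : ι → ℝ)
    (hinj : ∀ i ∈ s, ∀ j ∈ s, a i = a j → v i = v j → i = j)
    (h : ∀ t : ℝ, ∑ i ∈ s, c i * Real.exp (a i * t + v i * t ^ 2) = 0) : ∀ i ∈ s, c i = 0 := by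
  classical
  -- The lexicographically largest `(v, a)` dominates as `t → ∞`. Dividing by its exponential leaves
  -- `c i` plus terms tending to zero.
  induction s using Finset.induction_on_max_value (fun i => toLex (v i, a i)) with
  | empty => simp
  | insert i s hi hmax ih =>
    have hlim : Tendsto (fun t : ℝ => c i + ∑ j ∈ s, c j *
        Real.exp ((a j - a i) * t + (v j - v i) * t ^ 2)) atTop (𝓝 (c i + ∑ j ∈ s, c j * 0)) := by
      refine tendsto_const_nhds.add (tendsto_finsetSum _ fun j hj => ?_)
      refine (tendsto_exp_linear_add_sq ?_).const_mul _
      have hne : j ≠ i := fun e => hi (e ▸ hj)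
      have hle := hmax j hj
      rw [Prod.Lex.toLex_le_toLex] at hle
      rcases hle with hlt | ⟨heq, hle⟩
      · exact Or.inl (sub_neg.mpr hlt)
      · refine Or.inr ⟨sub_eq_zero.mpr heq, sub_neg.mpr (lt_of_le_of_ne hle fun e => hne ?_)⟩
        exact hinj j (Finset.mem_insert_of_mem hj) i (Finset.mem_insert_self _ _) e heq
    have hzero : ∀ t : ℝ, c i + ∑ j ∈ s, c j *
        Real.exp ((a j - a i) * t + (v j - v i) * t ^ 2) = 0 := by
      intro t
      have := congrArg (· * Real.exp (-(a i * t + v i * t ^ 2))) (h t)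
      simp only [Finset.sum_insert hi, add_mul, Finset.sum_mul, zero_mul, mul_assoc,
        ← Real.exp_add, add_neg_cancel, Real.exp_zero, mul_one] at this
      rw [← this]
      congr 1
      refine Finset.sum_congr rfl fun j _ => ?_
      congr 2
      ring
    have hci : c i = 0 := by
      simp only [hzero, mul_zero, Finset.sum_const_zero, add_zero] at hlim
      exact (tendsto_nhds_unique hlim tendsto_const_nhds)
    have hs := ih (fun j hj k hk => hinj j (Finset.mem_insert_of_mem hj) k
      (Finset.mem_insert_of_mem hk)) fun t => by
        have := h t
        rwa [Finset.sum_insert hi, hci, zero_mul, zero_add] at this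
    intro j hj
    rcases Finset.mem_insert.mp hj with rfl | hj
    · exact hci
    · exact hs j hj

/-- The characteristic function at `t` involves the covariance only through its value at `(t, t)`,
so the quadratic form suffices. -/
theorem gaussian_ext_of_forall {d : ℕ} {μ ν : Measure (Rd d)} [IsGaussian μ] [IsGaussian ν]
    (hm : ∀ x : Rd d, inner ℝ x (∫ y, y ∂μ) = inner ℝ x (∫ y, y ∂ν))
    (hv : ∀ x : Rd d, covarianceBilin μ x x = covarianceBilin ν x x) : μ = ν := by
  refine Measure.ext_of_charFun ?_
  ext t
  simp only [IsGaussian.charFun_eq', id, hm, hv]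

/-- Finitely many distinct Gaussian measures are separated by their means and variances along some
common direction. -/
theorem exists_separating_direction {d : ℕ} (s : Finset (Measure (Rd d)))
    (hs : ∀ ρ ∈ s, IsGaussian ρ) :
    ∃ x : Rd d, ∀ ρ ∈ s, ∀ σ ∈ s, inner ℝ x (∫ y, y ∂ρ) = inner ℝ x (∫ y, y ∂σ) →
      covarianceBilin ρ x x = covarianceBilin σ x x → ρ = σ := by
  classical
  -- Mean and variance along a direction are polynomials in that direction.
  let P : Measure (Rd d) → MvPolynomial (Fin d) ℝ := fun ρ =>
    ∑ a, MvPolynomial.C ((∫ y, y ∂ρ) a) * MvPolynomial.X a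
  let Q : Measure (Rd d) → MvPolynomial (Fin d) ℝ := fun ρ =>
    ∑ a, ∑ b, MvPolynomial.X a * MvPolynomial.X b *
      MvPolynomial.C (cov[fun z : Rd d => z a, fun z => z b; ρ])
  have hP : ∀ (ρ : Measure (Rd d)) (x : Rd d),
      MvPolynomial.eval x (P ρ) = inner ℝ x (∫ y, y ∂ρ) := by
    intro ρ x
    simp [P, PiLp.inner_apply]
  have hQ : ∀ ρ ∈ s, ∀ x : Rd d, MvPolynomial.eval x (Q ρ) = covarianceBilin ρ x x := by
    intro ρ hρ x
    have := hs ρ hρ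
    simp [Q, covarianceBilin_eq_sum_cov]
  -- A factor vanishes at a real direction exactly when mean and variance both agree there. No
  -- factor is the zero polynomial, since the two Gaussians would then coincide; the product is thus
  -- nonzero and has a nonvanishing point.
  let F := ∏ q ∈ s.offDiag, ((P q.1 - P q.2) ^ 2 + (Q q.1 - Q q.2) ^ 2)
  have hF : F ≠ 0 := by
    refine Finset.prod_ne_zero_iff.mpr fun q hq h0 => ?_
    obtain ⟨h1, h2, hne⟩ := Finset.mem_offDiag.mp hq
    have := hs _ h1
    have := hs _ h2
    have key : ∀ x : Rd d, inner ℝ x (∫ y, y ∂q.1) = inner ℝ x (∫ y, y ∂q.2) ∧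
        covarianceBilin q.1 x x = covarianceBilin q.2 x x := by
      intro x
      have hx := congrArg (MvPolynomial.eval x) h0
      simp only [map_add, map_pow, map_sub, hP, hQ _ h1, hQ _ h2, map_zero] at hx
      constructor <;> nlinarith
    exact hne (gaussian_ext_of_forall (fun x => (key x).1) fun x => (key x).2)
  obtain ⟨x, hx⟩ : ∃ x : Fin d → ℝ, MvPolynomial.eval x F ≠ 0 := by
    by_contra! h
    exact hF (MvPolynomial.funext fun x => by simpa using h x)
  refine ⟨WithLp.toLp 2 x, fun ρ hρ σ hσ hm hv => ?_⟩
  by_contra hne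
  rw [map_prod] at hx
  have hxq := Finset.prod_ne_zero_iff.mp hx (ρ, σ) (Finset.mem_offDiag.mpr ⟨hρ, hσ, hne⟩)
  have h1 := hP ρ (WithLp.toLp 2 x)
  have h2 := hP σ (WithLp.toLp 2 x)
  have h3 := hQ ρ hρ (WithLp.toLp 2 x)
  have h4 := hQ σ hσ (WithLp.toLp 2 x)
  simp only at h1 h2 h3 h4
  simp only [map_add, map_pow, map_sub, h1, h2, h3, h4, hm, hv, sub_self] at hxq
  norm_num at hxq

theorem map_inner_gaussian {d : ℕ} (ρ : Measure (Rd d)) [IsGaussian ρ] (x : Rd d) :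
    ρ.map (fun y => inner ℝ x y) =
      gaussianReal (inner ℝ x (∫ y, y ∂ρ)) (covarianceBilin ρ x x).toNNReal := by
  have h := IsGaussian.map_eq_gaussianReal (μ := ρ) (innerSL ℝ x)
  have h2 := IsGaussian.integral_dual (μ := ρ) (innerSL ℝ x)
  rw [h2] at h
  rw [covarianceBilin_self IsGaussian.memLp_two_id]
  exact h

/-- Distinct Gaussian measures are linearly independent. -/
theorem gaussian_coeff_unique {d : ℕ} (s : Finset (Measure (Rd d)))
    (hs : ∀ ρ ∈ s, IsGaussian ρ) (a b : Measure (Rd d) → ℝ≥0)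
    (h : ∑ ρ ∈ s, a ρ • ρ = ∑ ρ ∈ s, b ρ • ρ) : ∀ ρ ∈ s, a ρ = b ρ := by
  obtain ⟨x, hx⟩ := exists_separating_direction s hs
  have hint : ∀ ρ ∈ s, ∀ t : ℝ, Integrable (fun y => Real.exp (t * inner ℝ x y)) ρ := by
    intro ρ hρ t
    have := hs ρ hρ
    have h1 := integrable_exp_mul_gaussianReal (μ := inner ℝ x (∫ y, y ∂ρ))
      (v := (covarianceBilin ρ x x).toNNReal) t
    rw [← map_inner_gaussian, integrable_map_measure (by fun_prop) (by fun_prop)] at h1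
    exact h1
  -- Exponential moments along the separating direction turn the measure identity into a relation
  -- between functions `exp (a t + v t²)` with distinct `(a, v)`.
  have hmgf : ∀ ρ ∈ s, ∀ t : ℝ, ∫ y, Real.exp (t * inner ℝ x y) ∂ρ =
      Real.exp (inner ℝ x (∫ y, y ∂ρ) * t + covarianceBilin ρ x x / 2 * t ^ 2) := by
    intro ρ hρ t
    have := hs ρ hρ
    have h1 := mgf_gaussianReal (map_inner_gaussian ρ x) t
    rw [Real.coe_toNNReal _ (covarianceBilin_self_nonneg x)] at h1
    rw [mgf] at h1
    rw [h1]
    congr 1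
    ring
  have hsum : ∀ (c : Measure (Rd d) → ℝ≥0) (t : ℝ),
      ∫ y, Real.exp (t * inner ℝ x y) ∂(∑ ρ ∈ s, c ρ • ρ) = ∑ ρ ∈ s, (c ρ : ℝ) *
        Real.exp (inner ℝ x (∫ y, y ∂ρ) * t + covarianceBilin ρ x x / 2 * t ^ 2) := by
    intro c t
    rw [integral_finsetSum_measure fun ρ hρ => (hint ρ hρ t).smul_measure_nnreal]
    refine Finset.sum_congr rfl fun ρ hρ => ?_
    rw [integral_smul_nnreal_measure, hmgf ρ hρ t]
    rfl
  have hzero := coeff_eq_zero_of_sum_exp_eq_zero s (fun ρ => (a ρ : ℝ) - b ρ)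
    (fun ρ => inner ℝ x (∫ y, y ∂ρ)) (fun ρ => covarianceBilin ρ x x / 2)
    (fun ρ hρ σ hσ h1 h2 => hx ρ hρ σ hσ h1 (by linarith)) fun t => by
      simp only [sub_mul, Finset.sum_sub_distrib]
      rw [← hsum a t, ← hsum b t, h, sub_self]
  intro ρ hρ
  exact NNReal.coe_injective (sub_eq_zero.mp (hzero ρ hρ))

open Classical in
-- Components may repeat, so only the total weight carried by each distinct measure is intrinsic.
-- This collects those totals.
theorem mixture_eq_sum_fiber {ι E : Type*} [Fintype ι] [MeasurableSpace E] (p : ι → ℝ≥0)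
    (μ : ι → Measure E) (s : Finset (Measure E)) (hs : ∀ i, μ i ∈ s) :
    mixture p μ = ∑ ρ ∈ s, (∑ i with μ i = ρ, p i) • ρ := by
  rw [mixture, ← Finset.sum_fiberwise_of_maps_to (g := μ) (t := s) fun i _ => hs i]
  refine Finset.sum_congr rfl fun ρ _ => ?_
  rw [Finset.sum_smul]
  exact Finset.sum_congr rfl fun i hi => by rw [(Finset.mem_filter.mp hi).2]

open Classical in
/-- Identifiability: two representations of a measure as a finite Gaussian mixture give the same
total weight to every Gaussian measure. -/
theorem fiber_weight_eq_of_mixture_eq {ι κ : Type*} [Fintype ι] [Fintype κ] {d : ℕ}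
    {p : ι → ℝ≥0} {q : κ → ℝ≥0} {μ : ι → Measure (Rd d)} {ν : κ → Measure (Rd d)}
    (hμ : ∀ i, IsGaussian (μ i)) (hν : ∀ k, IsGaussian (ν k))
    (h : mixture p μ = mixture q ν) (ρ : Measure (Rd d)) :
    ∑ i with μ i = ρ, p i = ∑ k with ν k = ρ, q k := by
  let s : Finset (Measure (Rd d)) := Finset.univ.image μ ∪ Finset.univ.image ν
  have hsμ : ∀ i, μ i ∈ s := fun i => by simp [s]
  have hsν : ∀ k, ν k ∈ s := fun k => by simp [s]
  by_cases hρ : ρ ∈ s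
  · rw [mixture_eq_sum_fiber p μ s hsμ, mixture_eq_sum_fiber q ν s hsν] at h
    refine gaussian_coeff_unique s (fun σ hσ => ?_) _ _ h ρ hρ
    rcases Finset.mem_union.mp hσ with hσ | hσ
    · obtain ⟨i, -, rfl⟩ := Finset.mem_image.mp hσ
      exact hμ i
    · obtain ⟨i, -, rfl⟩ := Finset.mem_image.mp hσ
      exact hν i
  · have h1 : ∀ i, μ i ≠ ρ := fun i e => hρ (e ▸ hsμ i)
    have h2 : ∀ k, ν k ≠ ρ := fun k e => hρ (e ▸ hsν k)
    simp [h1, h2]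

end GMMOT

namespace GMMOT

/-- The equality case of a termwise bound; finiteness is essential in `ℝ≥0∞`. It yields optimality
of the individual plans in the converse. -/
theorem eq_of_le_of_sum_le {ι : Type*} [Fintype ι] {f g : ι → ℝ≥0∞} (hfg : ∀ i, f i ≤ g i)
    (hf : ∑ i, f i ≠ ⊤) (h : ∑ i, g i ≤ ∑ i, f i) (i : ι) : f i = g i := by
  classical
  refine le_antisymm (hfg i) (le_of_not_gt fun hlt => h.not_gt ?_)
  rw [← Finset.add_sum_erase _ f (Finset.mem_univ i)] at hf ⊢
  rw [← Finset.add_sum_erase _ g (Finset.mem_univ i)]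
  exact ENNReal.add_lt_add_of_lt_of_le (ENNReal.add_ne_top.mp hf).2 hlt
    (Finset.sum_le_sum fun j _ => hfg j)

/-! ### Mixtures and couplings -/

section Mixture

variable {ι E F : Type*} [Fintype ι] [MeasurableSpace E] [MeasurableSpace F]

theorem map_mixture (w : ι → ℝ≥0) (γ : ι → Measure E) {f : E → F} (hf : Measurable f) :
    (mixture w γ).map f = mixture w fun k => (γ k).map f := by
  simp only [mixture]
  rw [Measure.map_finset_sum hf.aemeasurable]
  simp only [Measure.map_smul]

theorem mixture_congr {w : ι → ℝ≥0} {γ γ' : ι → Measure E} (h : ∀ k, w k ≠ 0 → γ k = γ' k) :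
    mixture w γ = mixture w γ' := by
  refine Finset.sum_congr rfl fun k _ => ?_
  by_cases hk : w k = 0
  · simp [hk]
  · rw [h k hk]

theorem mixture_const (w : ι → ℝ≥0) (μ : Measure E) :
    mixture w (fun _ => μ) = (∑ k, w k) • μ :=
  (Finset.sum_smul).symm

theorem isProbabilityMeasure_mixture {w : ι → ℝ≥0} (hw : ∑ k, w k = 1) {γ : ι → Measure E}
    (hγ : ∀ k, IsProbabilityMeasure (γ k)) : IsProbabilityMeasure (mixture w γ) := by
  constructor
  have : ∑ k, (w k : ℝ≥0∞) = 1 := by exact_mod_cast congrArg ((↑) : ℝ≥0 → ℝ≥0∞) hw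
  rw [mixture, Measure.finsetSum_apply, ← this]
  refine Finset.sum_congr rfl fun k _ => ?_
  rw [Measure.smul_apply, measure_univ, ENNReal.smul_def, smul_eq_mul, mul_one]

theorem isGMM_mixture [TopologicalSpace E] [AddCommMonoid E] [Module ℝ E] {w : ι → ℝ≥0}
    (hw : ∑ k, w k = 1) {γ : ι → Measure E} (hγ : ∀ k, IsGaussian (γ k)) :
    IsGMM (mixture w γ) := by
  let e := Fintype.equivFin ι
  refine ⟨Fintype.card ι, w ∘ e.symm, γ ∘ e.symm, ?_, fun k => hγ _, ?_⟩
  · rw [← hw]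
    exact e.symm.sum_comp w
  · exact (e.symm.sum_comp fun k => w k • γ k).symm

theorem IsGMM.of_isGaussian [TopologicalSpace E] [AddCommMonoid E] [Module ℝ E] {γ : Measure E}
    (hγ : IsGaussian γ) : IsGMM γ := by
  have h := isGMM_mixture (ι := Unit) (w := fun _ => 1) (γ := fun _ => γ) (by simp) fun _ => hγ
  simpa [mixture] using h

theorem planCost_mixture {J d : ℕ} (lam : Fin J → ℝ) (w : ι → ℝ≥0)
    (γ : ι → Measure (Fin J → Rd d)) :
    planCost lam (mixture w γ) = ∑ k, (w k : ℝ≥0∞) * planCost lam (γ k) := by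
  simp only [planCost, mixture]
  rw [lintegral_finsetSum_measure]
  refine Finset.sum_congr rfl fun k _ => ?_
  rw [lintegral_smul_measure]
  rfl

end Mixture

/-! ### The discrete linear program -/

section Tensor

variable {J d : ℕ} {K : Fin J → ℕ} {p : ∀ j, Fin (K j) → ℝ≥0} {w : (∀ j, Fin (K j)) → ℝ≥0}

theorem sum_eq_one_of_mem_tensorCouplings (hp : ∀ j, ∑ k, p j k = 1)
    (hw : w ∈ tensorCouplings p) (j : Fin J) : ∑ κ, w κ = 1 := by
  rw [← hp j, ← Finset.sum_fiberwise Finset.univ (fun κ : ∀ j, Fin (K j) => κ j) w]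
  exact Finset.sum_congr rfl fun k _ => hw j k

theorem sum_filter_prod {r : ∀ j, Fin (K j) → ℝ≥0} (hr : ∀ j, ∑ k, r j k = 1) (j : Fin J)
    (k : Fin (K j)) : ∑ κ : (∀ j, Fin (K j)) with κ j = k, ∏ i, r i (κ i) = r j k := by
  classical
  -- Cutting the `j`-th factor down to its value at `k` absorbs the constraint `κ j = k`, so the sum
  -- of products becomes a product of sums.
  let r' : ∀ i, Fin (K i) → ℝ≥0 := Function.update r j (Pi.single k (r j k))
  have h1 : ∀ κ : ∀ j, Fin (K j), ∏ i, r' i (κ i) = if κ j = k then ∏ i, r i (κ i) else 0 := by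
    intro κ
    split_ifs with h
    · refine Finset.prod_congr rfl fun i _ => ?_
      by_cases hi : i = j
      · subst hi
        simp [r', h]
      · simp [r', hi]
    · exact Finset.prod_eq_zero (Finset.mem_univ j) (by simp [r', h])
  rw [Finset.sum_filter]
  simp only [← h1]
  rw [← Fintype.prod_sum, Fintype.prod_eq_single j fun i hi => by simp [r', hi, hr]]
  simp [r']

theorem nonempty_tensorCouplings (hp : ∀ j, ∑ k, p j k = 1) : (tensorCouplings p).Nonempty :=
  ⟨fun κ => ∏ i, p i (κ i), fun j k => sum_filter_prod hp j k⟩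

/-- One marginal constraint already fixes the total mass at one and bounds every entry by one. The
index `j` supplies it: for `J = 0` the mass would be unconstrained. -/
theorem isCompact_tensorCouplings (hp : ∀ j, ∑ k, p j k = 1) (j : Fin J) :
    IsCompact (tensorCouplings p) := by
  have hcl : IsClosed (tensorCouplings p) := by
    have : tensorCouplings p = ⋂ j, ⋂ k, {w | ∑ κ with κ j = k, w κ = p j k} := by
      ext w
      simp [tensorCouplings]
    rw [this]
    exact isClosed_iInter fun j => isClosed_iInter fun k =>
      isClosed_eq (continuous_finsetSum _ fun κ _ => continuous_apply κ) continuous_const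
  have hK : IsCompact (Set.univ.pi fun _ : (∀ j, Fin (K j)) => Set.Icc (0 : ℝ≥0) 1) :=
    isCompact_univ_pi fun _ => isCompact_Icc
  refine hK.of_isClosed_subset hcl fun w hw κ _ => ⟨zero_le, ?_⟩
  rw [← sum_eq_one_of_mem_tensorCouplings hp hw j]
  exact Finset.single_le_sum (fun _ _ => zero_le) (Finset.mem_univ κ)

theorem discreteCost_lt_top {lam : Fin J → ℝ} (hlam : ∀ j, 0 ≤ lam j)
    {comp : ∀ j, Fin (K j) → Measure (Rd d)} (hcomp : ∀ j k, IsGaussian (comp j k))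
    (w : (∀ j, Fin (K j)) → ℝ≥0) : discreteCost lam comp w < ⊤ :=
  ENNReal.sum_lt_top.mpr fun _ _ =>
    ENNReal.mul_lt_top ENNReal.coe_lt_top (mmW2sq_lt_top hlam fun _ => hcomp _ _)

theorem exists_isOptimalTensor {lam : Fin J → ℝ} (hlam : ∀ j, 0 ≤ lam j)
    (hp : ∀ j, ∑ k, p j k = 1) (j : Fin J)
    {comp : ∀ j, Fin (K j) → Measure (Rd d)} (hcomp : ∀ j k, IsGaussian (comp j k)) :
    ∃ w, IsOptimalTensor lam p comp w := by
  have hcont : Continuous (discreteCost lam comp) := by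
    refine continuous_finsetSum _ fun κ _ => ?_
    exact (ENNReal.continuous_mul_const (mmW2sq_lt_top hlam fun _ => hcomp _ _).ne).comp
      (ENNReal.continuous_coe.comp (continuous_apply κ))
  obtain ⟨w, hw, hmin⟩ := (isCompact_tensorCouplings hp j).exists_isMinOn
    (nonempty_tensorCouplings hp) hcont.continuousOn
  exact ⟨w, hw, fun w' hw' => hmin hw'⟩

theorem mixture_mem_couplings (hp : ∀ j, ∑ k, p j k = 1) (j₀ : Fin J)
    {comp : ∀ j, Fin (K j) → Measure (Rd d)} {γ : (∀ j, Fin (K j)) → Measure (Fin J → Rd d)}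
    (hw : w ∈ tensorCouplings p) (hγ : ∀ κ, γ κ ∈ couplings fun j => comp j (κ j)) :
    mixture w γ ∈ couplings fun j => mixture (p j) (comp j) := by
  refine ⟨isProbabilityMeasure_mixture (sum_eq_one_of_mem_tensorCouplings hp hw j₀)
    fun κ => (hγ κ).1, fun j => ?_⟩
  rw [map_mixture w γ (measurable_pi_apply j)]
  simp only [fun κ => (hγ κ).2 j]
  rw [mixture, mixture,
    ← Finset.sum_fiberwise Finset.univ (fun κ : ∀ j, Fin (K j) => κ j)]
  refine Finset.sum_congr rfl fun k _ => ?_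
  rw [← hw j k, Finset.sum_smul]
  exact Finset.sum_congr rfl fun κ hκ => by rw [(Finset.mem_filter.mp hκ).2]

open Classical in
/-- Splitting weights `q` along relations `R j` to the index sets carrying the weights `p j`, when
`q` and `p j` have the same total weight on related classes. -/
theorem exists_weight_splitting {ι : Type*} [Fintype ι] (p : ∀ j, Fin (K j) → ℝ≥0)
    (q : ι → ℝ≥0) (R : ∀ j, ι → Fin (K j) → Prop)
    (hq : ∀ j l, q l ≤ ∑ k with R j l k, p j k) (hp : ∀ j k, p j k ≤ ∑ l with R j l k, q l)
    (hpq : ∀ j l k, R j l k → ∑ k' with R j l k', p j k' = ∑ l' with R j l' k, q l') :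
    ∃ v : ι → (∀ j, Fin (K j)) → ℝ≥0, (∀ l, ∑ κ, v l κ = q l) ∧
      (∀ l κ, v l κ ≠ 0 → ∀ j, R j l (κ j)) ∧ (fun κ => ∑ l, v l κ) ∈ tensorCouplings p := by
  let P : Fin J → ι → ℝ≥0 := fun j l => ∑ k with R j l k, p j k
  -- The conditional law of `k` given the class related to `l`. The splitting draws the indices `κ
  -- j` independently from these laws. If `P j l = 0` then `q l = 0`, so the default value of the
  -- division is harmless.
  let r : ι → ∀ j, Fin (K j) → ℝ≥0 := fun l j k => if R j l k then p j k / P j l else 0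
  have hr : ∀ l, q l ≠ 0 → ∀ j, ∑ k, r l j k = 1 := by
    intro l hl j
    have hP : P j l ≠ 0 := fun h => hl (le_antisymm (h ▸ hq j l) (zero_le))
    simp only [r, ← Finset.sum_filter, ← Finset.sum_div]
    exact div_self hP
  refine ⟨fun l κ => q l * ∏ j, r l j (κ j), fun l => ?_, fun l κ h j => ?_, fun j k => ?_⟩
  · by_cases hl : q l = 0
    · simp [hl]
    · rw [← Finset.mul_sum, ← Fintype.prod_sum]
      simp [hr l hl]
  · by_contra hR
    have h0 : ∏ j, r l j (κ j) = 0 :=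
      Finset.prod_eq_zero (Finset.mem_univ j) (by simp [r, hR])
    exact h (by simp only [h0, mul_zero])
  · rw [Finset.sum_comm]
    have h1 : ∀ l, ∑ κ : (∀ j, Fin (K j)) with κ j = k, q l * ∏ i, r l i (κ i) =
        q l * r l j k := by
      intro l
      by_cases hl : q l = 0
      · simp [hl]
      · rw [← Finset.mul_sum, sum_filter_prod (hr l hl)]
    -- By `hpq` the denominator becomes the `q`-weight of the class of `k`, independent of `l`, and
    -- cancels on summing over `l`.
    have h2 : ∀ l, q l * r l j k =
        if R j l k then q l * (p j k / ∑ l' with R j l' k, q l') else 0 := by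
      intro l
      simp only [r]
      split_ifs with h
      · rw [← hpq j l k h]
      · simp
    simp only [h1, h2]
    rw [← Finset.sum_filter, ← Finset.sum_mul]
    by_cases h0 : ∑ l with R j l k, q l = 0
    · have := hp j k
      rw [h0] at this ⊢
      rw [zero_mul, le_antisymm this (zero_le)]
    · exact mul_div_cancel₀ _ h0

/-- A Gaussian mixture coupling of Gaussian mixtures is a mixture of Gaussian mixture couplings of
the components. -/
theorem exists_decomposition {comp : ∀ j, Fin (K j) → Measure (Rd d)}
    (hcomp : ∀ j k, IsGaussian (comp j k)) {γ : Measure (Fin J → Rd d)}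
    (hγ : γ ∈ couplings fun j => mixture (p j) (comp j)) (hG : IsGMM γ) :
    ∃ w ∈ tensorCouplings p, ∃ γ' : (∀ j, Fin (K j)) → Measure (Fin J → Rd d),
      (∀ κ, w κ ≠ 0 → IsGMM (γ' κ) ∧ γ' κ ∈ couplings fun j => comp j (κ j)) ∧
      γ = mixture w γ' := by
  classical
  obtain ⟨N, q, ν, -, hν, rfl⟩ := hG
  have hνj : ∀ j l, IsGaussian ((ν l).map fun x => x j) := fun j l =>
    have := hν l
    isGaussian_map (ContinuousLinearMap.proj (R := ℝ) (φ := fun _ : Fin J => Rd d) j)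
  have hid : ∀ j ρ, ∑ k with comp j k = ρ, p j k =
      ∑ l with (ν l).map (fun x => x j) = ρ, q l := by
    intro j ρ
    refine fiber_weight_eq_of_mixture_eq (hcomp j) (hνj j) ?_ ρ
    rw [← map_mixture q ν (measurable_pi_apply j)]
    exact (hγ.2 j).symm
  -- An index `k` is related to `l` when the `k`-th component is the `j`-th marginal of `ν l`;
  -- identifiability (`hid`) supplies the weight conditions.
  obtain ⟨v, hvq, hvR, hvp⟩ := exists_weight_splitting p q
    (fun j l k => comp j k = (ν l).map fun x => x j)
    (fun j l => by
      rw [hid j]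
      exact Finset.single_le_sum (f := q) (fun _ _ => zero_le) (by simp))
    (fun j k => by
      simp only [eq_comm (a := comp j k)]
      rw [← hid j]
      exact Finset.single_le_sum (f := p j) (fun _ _ => zero_le) (by simp))
    (fun j l k h => by
      rw [hid j]
      simp only [← h, eq_comm (a := comp j k)])
  let w : (∀ j, Fin (K j)) → ℝ≥0 := fun κ => ∑ l, v l κ
  -- The plan at `κ` is the normalized share of the `ν l` assigned to `κ`. When `w κ = 0` division
  -- gives the zero measure, which is no coupling, so claims are made only for nonzero weights.
  refine ⟨w, hvp, fun κ => mixture (fun l => v l κ / w κ) ν, fun κ hκ => ?_, ?_⟩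
  · have h1 : ∑ l, v l κ / w κ = 1 := by
      rw [← Finset.sum_div]
      exact div_self hκ
    refine ⟨isGMM_mixture h1 hν,
      isProbabilityMeasure_mixture h1 fun l => (hν l).toIsProbabilityMeasure, fun j => ?_⟩
    rw [map_mixture _ ν (measurable_pi_apply j),
      mixture_congr (γ' := fun _ => comp j (κ j)), mixture_const, h1, one_smul]
    intro l hl
    exact (hvR l κ (fun h0 => hl (by simp [h0])) j).symm
  · simp only [mixture, Finset.smul_sum, smul_smul]
    rw [Finset.sum_comm]
    refine Finset.sum_congr rfl fun l _ => ?_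
    rw [← hvq l, Finset.sum_smul]
    refine Finset.sum_congr rfl fun κ _ => ?_
    congr 1
    by_cases hκ : w κ = 0
    · rw [hκ, zero_mul]
      exact (Finset.sum_eq_zero_iff.mp hκ) l (Finset.mem_univ l)
    · exact (mul_div_cancel₀ _ hκ).symm

end Tensor

end GMMOT

/-! ### Comparison of the mixture problem with the discrete program. -/

theorem mainTheorem4 {J d : ℕ}
    (lam : Fin J → ℝ) (hlam : ∀ j, 0 ≤ lam j) (hlam_sum : ∑ j, lam j = 1)
    (K : Fin J → ℕ)
    (p : ∀ j, Fin (K j) → ℝ≥0) (hp : ∀ j, ∑ k, p j k = 1)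
    (comp : ∀ j, Fin (K j) → Measure (GMMOT.Rd d)) (hcomp : ∀ j k, IsGaussian (comp j k))
    (μ : Fin J → Measure (GMMOT.Rd d)) (hμ : ∀ j, μ j = GMMOT.mixture (p j) (comp j)) :
    -- the value is finite, and it is the minimum of the discrete linear program
    GMMOT.MMW2sq lam μ < ⊤ ∧
    IsLeast (GMMOT.discreteCost lam comp '' GMMOT.tensorCouplings p) (GMMOT.MMW2sq lam μ) ∧
    -- each tuple of Gaussian components has a Gaussian optimal multi-marginal plan
    (∀ κ : ∀ j, Fin (K j), ∃ γ : Measure (Fin J → GMMOT.Rd d),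
      IsGaussian γ ∧ GMMOT.IsOptimalPlan lam (fun j => comp j (κ j)) γ) ∧
    -- mixing Gaussian optimal plans with a solution of the linear program gives a solution
    (∀ (w : (∀ j, Fin (K j)) → ℝ≥0) (γ : (∀ j, Fin (K j)) → Measure (Fin J → GMMOT.Rd d)),
      GMMOT.IsOptimalTensor lam p comp w →
      (∀ κ, IsGaussian (γ κ) ∧ GMMOT.IsOptimalPlan lam (fun j => comp j (κ j)) (γ κ)) →
      GMMOT.IsOptimalGMMPlan lam μ (GMMOT.mixture w γ)) ∧
    -- every solution is such a mixture of optimal plans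
    (∀ γs : Measure (Fin J → GMMOT.Rd d), GMMOT.IsOptimalGMMPlan lam μ γs →
      ∃ (w : (∀ j, Fin (K j)) → ℝ≥0) (γ : (∀ j, Fin (K j)) → Measure (Fin J → GMMOT.Rd d)),
        GMMOT.IsOptimalTensor lam p comp w ∧
        (∀ κ, GMMOT.IsGMM (γ κ) ∧ GMMOT.IsOptimalPlan lam (fun j => comp j (κ j)) (γ κ)) ∧
        γs = GMMOT.mixture w γ) := by
  obtain rfl : μ = fun j => GMMOT.mixture (p j) (comp j) := funext hμ
  have hJ : Nonempty (Fin J) := by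
    -- An empty sum of weights would be `0`, not `1`; hence `J ≥ 1`.
    by_contra h
    rw [not_nonempty_iff] at h
    simp at hlam_sum
  obtain ⟨j₀⟩ := hJ
  have hplan : ∀ κ : ∀ j, Fin (K j), ∃ γ : Measure (Fin J → GMMOT.Rd d),
      IsGaussian γ ∧ GMMOT.IsOptimalPlan lam (fun j => comp j (κ j)) γ :=
    fun κ => GMMOT.exists_isGaussian_isOptimalPlan hlam fun j => hcomp j (κ j)
  choose γ₀ hγ₀G hγ₀ using hplan
  have hmix : ∀ (w : (∀ j, Fin (K j)) → ℝ≥0)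
      (γ : (∀ j, Fin (K j)) → Measure (Fin J → GMMOT.Rd d)), w ∈ GMMOT.tensorCouplings p →
      (∀ κ, IsGaussian (γ κ) ∧ GMMOT.IsOptimalPlan lam (fun j => comp j (κ j)) (γ κ)) →
      GMMOT.mixture w γ ∈ GMMOT.couplings (fun j => GMMOT.mixture (p j) (comp j)) ∧
      GMMOT.IsGMM (GMMOT.mixture w γ) ∧
      GMMOT.planCost lam (GMMOT.mixture w γ) = GMMOT.discreteCost lam comp w := by
    intro w γ hw hγ
    refine ⟨GMMOT.mixture_mem_couplings hp j₀ hw fun κ => (hγ κ).2.1,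
      GMMOT.isGMM_mixture (GMMOT.sum_eq_one_of_mem_tensorCouplings hp hw j₀)
        fun κ => (hγ κ).1, ?_⟩
    rw [GMMOT.planCost_mixture, GMMOT.discreteCost]
    exact Finset.sum_congr rfl fun κ _ => by rw [(hγ κ).2.2]
  have hlower : ∀ (w : (∀ j, Fin (K j)) → ℝ≥0)
      (γ : (∀ j, Fin (K j)) → Measure (Fin J → GMMOT.Rd d)),
      (∀ κ, w κ ≠ 0 → γ κ ∈ GMMOT.couplings fun j => comp j (κ j)) → ∀ κ,
      (w κ : ℝ≥0∞) * GMMOT.mmW2sq lam (fun j => comp j (κ j)) ≤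
        (w κ : ℝ≥0∞) * GMMOT.planCost lam (γ κ) := by
    intro w γ hγ κ
    by_cases hκ : w κ = 0
    · simp [hκ]
    · gcongr
      exact iInf₂_le _ (hγ κ hκ)
  have hle : ∀ w ∈ GMMOT.tensorCouplings p,
      GMMOT.MMW2sq lam (fun j => GMMOT.mixture (p j) (comp j)) ≤
        GMMOT.discreteCost lam comp w := by
    intro w hw
    obtain ⟨h1, h2, h3⟩ := hmix w γ₀ hw fun κ => ⟨hγ₀G κ, hγ₀ κ⟩
    exact h3 ▸ iInf₂_le _ ⟨h1, h2⟩
  have hval : ∀ w, GMMOT.IsOptimalTensor lam p comp w →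
      GMMOT.MMW2sq lam (fun j => GMMOT.mixture (p j) (comp j)) =
        GMMOT.discreteCost lam comp w := by
    intro w hw
    refine le_antisymm (hle w hw.1) (le_iInf₂ fun γ hγ => ?_)
    obtain ⟨w', hw', γ', hγ', rfl⟩ := GMMOT.exists_decomposition hcomp hγ.1 hγ.2
    refine (hw.2 w' hw').trans ?_
    rw [GMMOT.planCost_mixture]
    exact Finset.sum_le_sum fun κ _ => hlower w' γ' (fun κ hκ => (hγ' κ hκ).2) κ
  obtain ⟨w₀, hw₀⟩ := GMMOT.exists_isOptimalTensor hlam hp j₀ hcomp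
  have hfin : GMMOT.MMW2sq lam (fun j => GMMOT.mixture (p j) (comp j)) < ⊤ :=
    hval w₀ hw₀ ▸ GMMOT.discreteCost_lt_top hlam hcomp w₀
  refine ⟨hfin, ⟨⟨w₀, hw₀.1, (hval w₀ hw₀).symm⟩, ?_⟩, fun κ => ⟨γ₀ κ, hγ₀G κ, hγ₀ κ⟩, ?_, ?_⟩
  · rintro _ ⟨w, hw, rfl⟩
    exact hle w hw
  · intro w γ hw hγ
    obtain ⟨h1, h2, h3⟩ := hmix w γ hw.1 hγ
    exact ⟨h1, h2, h3.trans (hval w hw).symm⟩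
  · rintro γs ⟨hγc, hγG, hγcost⟩
    obtain ⟨w, hw, γ', hγ', rfl⟩ := GMMOT.exists_decomposition hcomp hγc hγG
    rw [GMMOT.planCost_mixture] at hγcost
    have hterm := hlower w γ' fun κ hκ => (hγ' κ hκ).2
    have hcost_le : GMMOT.discreteCost lam comp w ≤
        GMMOT.MMW2sq lam (fun j => GMMOT.mixture (p j) (comp j)) :=
      hγcost ▸ Finset.sum_le_sum fun κ _ => hterm κ
    have hopt : GMMOT.IsOptimalTensor lam p comp w :=
      ⟨hw, fun w' hw' => hcost_le.trans (hle w' hw')⟩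
    -- Optimality of the plan forces equality of the two finite totals, hence of every term;
    -- cancelling a nonzero `w κ` makes `γ' κ` optimal.
    have heq : ∀ κ, (w κ : ℝ≥0∞) * GMMOT.mmW2sq lam (fun j => comp j (κ j)) =
        (w κ : ℝ≥0∞) * GMMOT.planCost lam (γ' κ) := by
      refine GMMOT.eq_of_le_of_sum_le hterm (GMMOT.discreteCost_lt_top hlam hcomp w).ne ?_
      rw [hγcost]
      exact hle w hw
    classical
    -- At zero weight the decomposition provides no plan, so the Gaussian optimal plan `γ₀ κ` is
    -- substituted, leaving the mixture unchanged.
    refine ⟨w, fun κ => if w κ = 0 then γ₀ κ else γ' κ, hopt, fun κ => ?_,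
      GMMOT.mixture_congr fun κ hκ => by simp [hκ]⟩
    by_cases hκ : w κ = 0
    · simp only [hκ, if_true]
      exact ⟨.of_isGaussian (hγ₀G κ), hγ₀ κ⟩
    · simp only [hκ, if_false]
      refine ⟨(hγ' κ hκ).1, (hγ' κ hκ).2, ?_⟩
      have h := heq κ
      rw [ENNReal.mul_right_inj (by exact_mod_cast hκ) ENNReal.coe_ne_top] at h
      exact h.symm
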